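/- Let $G$ be a finitely generated group which is hyperbolic relative to a finite collection $\mathcal P$ of subgroups. Let $\mathcal H=\{H_1,\dots,H_n\}$ be a finite collection of subgroups of $G$ such that each $H_k$ is - relatively quasi-convex in $(G,\mathcal P)$; - full, i.e. for all $g\in G$ and $P\in\mathcal P$ the subgroup $gH_kg^{-1}\cap P$ is either finite or of finite index in $P$; and - of codimension $1$, i.e. the quotient $H_k\backslash\Gamma$ of a Cayley graph $\Gamma$ of $G$ (with respect to a finite generating set) has more than one end. For each $k$ let $A_k\subseteq G$ be a set with $H_kA_k=A_k$ such that the images in $H_k\backslash G$ of $A_k$ and of $G\smallsetminus A_k$ are infinite, and the image in $H_k\backslash G$ of the symmetric difference of $A_k$ and $A_kg$ is finite for every $g\in G$. Let $X$ be the CAT$(0)$ cube complex dual to $\mathcal H$ that the Sageev construction associates with these sets: its walls are the pairs $\{gA_k,\,G\smallsetminus gA_k\}$ with $g\in G$ and $1\le k\le n$; a vertex is a choice of one side of every wall such that any two chosen sides intersect and each element of $G$ lies in all but finitely many chosen sides; two vertices are joined by an edge if they differ on exactly one wall, and every subgraph which is the $1$-skeleton of a cube is filled with a Euclidean unit cube.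 The group $G$ acts on $X$ by left translation of the walls. Then every one-ended $P\in\mathcal P$ acts elliptically on $X$: the complex $X$ is non-empty and every orbit of $P$ in $X$ is bounded in the CAT$(0)$ metric. -/

import Mathlib

open scoped Pointwise symmDiff ENNReal

namespace RelCube

noncomputable section

/-! ## Cayley graphs, coset graphs and ends -/

/-- The (right) Cayley graph of `G` with respect to a set `S`: edges join `g` and `g * s`, for
`s ∈ S`. The group acts on it by left multiplication. -/
def cayleyGraph {G : Type*} [Group G] (S : Set G) : SimpleGraph G :=
  SimpleGraph.fromRel fun g h => ∃ s ∈ S, h = g * s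

/-- The set `H \ G` of right cosets `H g`. -/
abbrev RightCosets {G : Type*} [Group G] (H : Subgroup G) : Type _ :=
  Quotient (QuotientGroup.rightRel H)

/-- The right coset `H g`. -/
def rightCoset {G : Type*} [Group G] (H : Subgroup G) (g : G) : RightCosets H :=
  Quotient.mk (QuotientGroup.rightRel H) g

/-- The coset graph, that is, the quotient by `H` of the Cayley graph of `G` with respect to `S`:
edges join `H g` and `H g s`, for `s ∈ S`. -/
def cosetGraph {G : Type*} [Group G] (H : Subgroup G) (S : Set G) :
    SimpleGraph (RightCosets H) :=
  SimpleGraph.fromRel fun a b => ∃ g, ∃ s ∈ S, a = rightCoset H g ∧ b = rightCoset H (g * s)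

/-- The number of ends of a (locally finite) graph: the supremum, over all finite sets `K` of
vertices, of the number of infinite connected components of the complement of `K`. -/
def numEnds {V : Type*} (Γ : SimpleGraph V) : ℕ∞ :=
  ⨆ K : Finset V, {C : Γ.ComponentCompl (K : Set V) | C.supp.Infinite}.encard

/-- A group is one-ended if it is finitely generated and its Cayley graph with respect to a
finite generating set has exactly one end. -/
def IsOneEnded (P : Type*) [Group P] : Prop :=
  ∃ T : Finset P, Subgroup.closure (T : Set P) = ⊤ ∧ numEnds (cayleyGraph (T : Set P)) = 1

/-- A subgroup `H` of a finitely generated group `G` has codimension one if the quotient by `H`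
of the Cayley graph of `G` with respect to a finite generating set has more than one end. -/
def IsCodimensionOne {G : Type*} [Group G] (H : Subgroup G) : Prop :=
  ∃ S : Finset G, Subgroup.closure (S : Set G) = ⊤ ∧ 2 ≤ numEnds (cosetGraph H (S : Set G))

/-! ## Relatively hyperbolic pairs and full relatively quasi-convex subgroups -/

/-- Gromov hyperbolicity of a connected graph, through the four-point condition on vertices. -/
def IsHyperbolicGraph {V : Type*} (Γ : SimpleGraph V) : Prop :=
  Γ.Connected ∧ ∃ δ : ℕ, ∀ x y z w : V,
    Γ.dist x y + Γ.dist z w ≤ max (Γ.dist x z + Γ.dist y w) (Γ.dist x w + Γ.dist y z) + δ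

/-- A graph is fine if every edge lies in only finitely many circuits of any given length. -/
def IsFineGraph {V : Type*} (Γ : SimpleGraph V) : Prop :=
  ∀ u v : V, Γ.Adj u v → ∀ n : ℕ,
    {c : Γ.Walk u u | c.IsCycle ∧ c.length = n ∧ s(u, v) ∈ c.edges}.Finite

/-- The coned-off Cayley graph: the Cayley graph of `G` with respect to `S`, together with one
cone vertex for each coset `g P i`, joined to all the elements of that coset. -/
def conedOffGraph {G : Type*} [Group G] {ι : Type*} (P : ι → Subgroup G) (S : Set G) :
    SimpleGraph (G ⊕ (Σ i, G ⧸ P i)) :=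
  SimpleGraph.fromRel fun a b =>
    match a, b with
    | Sum.inl g, Sum.inl h => ∃ s ∈ S, h = g * s
    | Sum.inl g, Sum.inr c => c.2 = (g : G ⧸ P c.1)
    | _, _ => False

/-- A finitely generated group `G` is hyperbolic relative to the finite family `P` of subgroups
if, for a finite generating set `S`, the coned-off Cayley graph is hyperbolic and fine. -/
def IsRelativelyHyperbolic {G : Type*} [Group G] {ι : Type*} (P : ι → Subgroup G) : Prop :=
  Finite ι ∧ ∃ S : Finset G, Subgroup.closure (S : Set G) = ⊤ ∧
    IsHyperbolicGraph (conedOffGraph P (S : Set G)) ∧ IsFineGraph (conedOffGraph P (S : Set G))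

/-- A subgroup `H` is relatively quasi-convex in `(G, P)` if, for a finite generating set `S` of
`G`, there is a constant `σ` such that every vertex of every geodesic with endpoints in `H` in
the Cayley graph with respect to `S ∪ ⋃ P i` is at `S`-distance at most `σ` from `H`. -/
def IsRelativelyQuasiconvex {G : Type*} [Group G] {ι : Type*} (P : ι → Subgroup G)
    (H : Subgroup G) : Prop :=
  ∃ S : Finset G, Subgroup.closure (S : Set G) = ⊤ ∧ ∃ σ : ℕ,
    ∀ a ∈ H, ∀ b ∈ H,
      ∀ γ : (cayleyGraph ((S : Set G) ∪ ⋃ i, (P i : Set G))).Walk a b,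
        γ.length = (cayleyGraph ((S : Set G) ∪ ⋃ i, (P i : Set G))).dist a b →
        ∀ v ∈ γ.support, ∃ h ∈ H, (cayleyGraph (S : Set G)).dist v h ≤ σ

/-- A subgroup `H` is full if the intersection of each of its conjugates with each `P i` is either
finite or of finite index in `P i`. -/
def IsFull {G : Type*} [Group G] {ι : Type*} (P : ι → Subgroup G) (H : Subgroup G) : Prop :=
  ∀ (g : G) (i : ι),
    Finite ((H.map (MulAut.conj g).toMonoidHom ⊓ P i : Subgroup G)) ∨
      ((H.map (MulAut.conj g).toMonoidHom).subgroupOf (P i)).FiniteIndex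

/-! ## The Sageev construction -/

/-- A set is `H`-finite if it has finite image in `H \ G`. -/
def IsHFinite {G : Type*} [Group G] (H : Subgroup G) (B : Set G) : Prop :=
  (rightCoset H '' B).Finite

/-- The subsets of `G` used in the Sageev construction for a codimension-one subgroup `H`:
the nontrivial `H`-almost invariant sets, that is, the preimages in `G` of the subsets of
`H \ G` which are infinite, have infinite complement and have finite coboundary. -/
structure IsAlmostInvariant {G : Type*} [Group G] (H : Subgroup G) (A : Set G) : Prop where
  smul_eq : ∀ h ∈ H, h • A = A
  coboundary : ∀ g : G, IsHFinite H (A ∆ (MulOpposite.op g • A))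
  infinite : ¬ IsHFinite H A
  infinite_compl : ¬ IsHFinite H Aᶜ

variable {G : Type*} [Group G] {κ : Type*}

/-- The halfspaces determined by a family of subsets of `G`: the translates of the members of the
family, and their complements. The walls are the pairs `{U, Uᶜ}`. -/
def halfspaces (A : κ → Set G) : Set (Set G) :=
  {U | ∃ (k : κ) (g : G), U = g • A k ∨ U = (g • A k)ᶜ}

/-- Vertices of the dual cube complex: a choice of one side of each wall such that any two chosen
halfspaces intersect and every element of `G` lies in all but finitely many of them. -/
structure IsVertex (A : κ → Set G) (v : Set (Set G)) : Prop where
  subset : v ⊆ halfspaces A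
  choice : ∀ U ∈ halfspaces A, Xor (U ∈ v) (Uᶜ ∈ v)
  inter : ∀ U ∈ v, ∀ V ∈ v, (U ∩ V).Nonempty
  finite : ∀ g : G, {U ∈ v | g ∉ U}.Finite

/-- Replace the halfspaces belonging to `E` by their complements. -/
def flip (v E : Set (Set G)) : Set (Set G) := (v \ E) ∪ {U | Uᶜ ∈ E}

/-- A set of vertices spans a cube if it consists of the vertices obtained from one of them, `v`,
by changing the sides of an arbitrary set of walls out of some finite set of walls (given by the
set `F` of their sides chosen by `v`). -/
def IsCube (A : κ → Set G) (C : Set (Set (Set G))) : Prop :=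
  (∀ w ∈ C, IsVertex A w) ∧
    ∃ v F : Set (Set G), F.Finite ∧ F ⊆ v ∧ C = {w | ∃ E ⊆ F, w = flip v E}

/-- A vertex as a point of the real vector space of functions on the set of subsets of `G`. -/
def vertexPoint (v : Set (Set G)) : Set G → ℝ := v.indicator 1

/-- The geometric cube spanned by a set of vertices. -/
def realize (C : Set (Set (Set G))) : Set (Set G → ℝ) := convexHull ℝ (vertexPoint '' C)

/-- The cube complex dual to the family `A`, as the union of its geometric cubes. -/
def DualCubeComplex (A : κ → Set G) : Type _ :=
  {x : Set G → ℝ // ∃ C, IsCube A C ∧ x ∈ realize C}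

/-- The Euclidean distance of two points in a common unit cube. The square of each coordinate
difference occurs twice in the sum, once for each side of the wall. -/
def euclDist (x y : Set G → ℝ) : ℝ := Real.sqrt ((∑ᶠ U, (x U - y U) ^ 2) / 2)

/-- The Euclidean distance of two points if they lie in a common cube, and `∞` otherwise. -/
def cubeDist {A : κ → Set G} (x y : DualCubeComplex A) : ℝ≥0∞ :=
  ⨅ _ : ∃ C, IsCube A C ∧ x.1 ∈ realize C ∧ y.1 ∈ realize C, ENNReal.ofReal (euclDist x.1 y.1)

/-- The `CAT(0)` metric of the dual cube complex, that is, the length metric induced by the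
Euclidean metrics of the cubes: the infimum of the lengths of all strings `x = c 0, …, c n = y` in
which any two consecutive points lie in a common cube. -/
def pathDist {A : κ → Set G} (x y : DualCubeComplex A) : ℝ≥0∞ :=
  ⨅ (n : ℕ) (c : ℕ → DualCubeComplex A) (_ : c 0 = x) (_ : c n = y),
    ∑ j ∈ Finset.range n, cubeDist (c j) (c (j + 1))

/-! ### The action of `G` on the dual cube complex -/

theorem smul_mem_halfspaces {A : κ → Set G} {U : Set G} (g : G) (hU : U ∈ halfspaces A) :
    g • U ∈ halfspaces A := by
  obtain ⟨k, a, rfl | rfl⟩ := hU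
  · exact ⟨k, g * a, Or.inl (by rw [mul_smul])⟩
  · exact ⟨k, g * a, Or.inr (by rw [mul_smul, Set.smul_set_compl])⟩

theorem IsVertex.smul {A : κ → Set G} {v : Set (Set G)} (hv : IsVertex A v) (g : G) :
    IsVertex A (g • v) where
  subset := by
    rintro _ ⟨U, hU, rfl⟩
    exact smul_mem_halfspaces g (hv.subset hU)
  choice U hU := by
    simp only [Set.mem_smul_set_iff_inv_smul_mem, Set.smul_set_compl]
    exact hv.choice _ (smul_mem_halfspaces g⁻¹ hU)
  inter := by
    rintro _ ⟨U, hU, rfl⟩ _ ⟨V, hV, rfl⟩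
    obtain ⟨x, hx⟩ := hv.inter U hU V hV
    exact ⟨g • x, Set.smul_mem_smul_set hx.1, Set.smul_mem_smul_set hx.2⟩
  finite a := by
    refine ((hv.finite (g⁻¹ * a)).image (fun U => g • U)).subset ?_
    rintro _ ⟨⟨U, hU, rfl⟩, ha⟩
    exact ⟨U, ⟨hU, fun h => ha (Set.mem_smul_set_iff_inv_smul_mem.2 h)⟩, rfl⟩

theorem smul_flip (g : G) (v E : Set (Set G)) : g • flip v E = flip (g • v) (g • E) := by
  ext U
  simp only [flip, Set.mem_smul_set_iff_inv_smul_mem, Set.mem_union, Set.mem_sdiff,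
    Set.mem_ofPred_eq, Set.smul_set_compl]

theorem IsCube.smul {A : κ → Set G} {C : Set (Set (Set G))} (hC : IsCube A C) (g : G) :
    IsCube A (g • C) := by
  obtain ⟨hv, v, F, hF, hFv, rfl⟩ := hC
  refine ⟨?_, g • v, g • F, hF.smul_set, Set.smul_set_mono hFv, ?_⟩
  · rintro _ ⟨w, hw, rfl⟩
    exact (hv w hw).smul g
  · ext w
    constructor
    · rintro ⟨_, ⟨E, hE, rfl⟩, rfl⟩
      exact ⟨g • E, Set.smul_set_mono hE, smul_flip g v E⟩
    · rintro ⟨E, hE, rfl⟩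
      refine ⟨flip v (g⁻¹ • E), ⟨g⁻¹ • E, ?_, rfl⟩, ?_⟩
      · simpa using Set.smul_set_mono (a := g⁻¹) hE
      · change g • flip v (g⁻¹ • E) = _
        rw [smul_flip, smul_inv_smul]

/-- Translation of functions on the set of subsets of `G`. -/
def translate (g : G) : (Set G → ℝ) →ₗ[ℝ] (Set G → ℝ) :=
  LinearMap.funLeft ℝ ℝ fun U : Set G => g⁻¹ • U

theorem translate_vertexPoint (g : G) (v : Set (Set G)) :
    translate g (vertexPoint v) = vertexPoint (g • v) := by
  classical
  ext U
  simp only [translate, LinearMap.funLeft_apply, vertexPoint, Set.indicator_apply,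
    Set.mem_smul_set_iff_inv_smul_mem, Pi.one_apply]

theorem translate_mem_realize {C : Set (Set (Set G))} {x : Set G → ℝ} (g : G)
    (hx : x ∈ realize C) : translate g x ∈ realize (g • C) := by
  have h : translate g x ∈ translate g '' convexHull ℝ (vertexPoint '' C) := ⟨x, hx, rfl⟩
  rw [LinearMap.image_convexHull, Set.image_image] at h
  refine convexHull_mono ?_ h
  rintro _ ⟨v, hv, rfl⟩
  exact ⟨g • v, Set.smul_mem_smul_set hv, (translate_vertexPoint g v).symm⟩

/-- The action of `G` on the dual cube complex induced by the action of `G` on the halfspaces. -/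
instance (A : κ → Set G) : MulAction G (DualCubeComplex A) where
  smul g x := ⟨translate g x.1, by
    obtain ⟨C, hC, hx⟩ := x.2
    exact ⟨g • C, hC.smul g, translate_mem_realize g hx⟩⟩
  one_smul x := Subtype.ext <| by
    change translate 1 x.1 = x.1
    ext U
    simp [translate, LinearMap.funLeft_apply]
  mul_smul g h x := Subtype.ext <| by
    change translate (g * h) x.1 = translate g (translate h x.1)
    ext U
    simp [translate, LinearMap.funLeft_apply, mul_smul]

/-- A subgroup `P` of `G` acts elliptically on the dual cube complex if the complex is nonempty
and all the orbits of `P` are bounded in the `CAT(0)` metric. -/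
def ActsElliptically (A : κ → Set G) (P : Subgroup G) : Prop :=
  Nonempty (DualCubeComplex A) ∧
    ∀ x : DualCubeComplex A, ∃ R : ℝ, ∀ p ∈ P, pathDist x (p • x) ≤ ENNReal.ofReal R

end

end RelCube

/-! Two vertices of the dual complex are at distance at most the number of walls on which they
differ (`IsVertex.pathDist_le`). An element `p` carries the vertex of all halfspaces containing `1`
to that of all halfspaces containing `p`, so it suffices to bound the number of halfspaces
separating `1` from `p`, uniformly in `p ∈ P` (`exists_separating_encard_le`).

Such a halfspace separates the ends of some edge of a Cayley graph of `P`, hence is a `P`-translate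
of one of the finitely many halfspaces separating `1` from a generator. Let `V` be one of these,
equal to `g • A k` up to complement. Fullness leaves two cases. If `gHₖg⁻¹ ∩ P` has finite index in
`P`, then `V` has finitely many `P`-translates. If it is finite, then `V ∩ P` is almost invariant in
`P`, so one-endedness makes it finite or cofinite, and this bounds the number of translates of `V`
that separate `1` from `p`. -/

namespace RelCube

/-! ### One-ended groups and their almost invariant subsets -/

section OneEnded

variable {P : Type*} [Group P]

theorem cayleyGraph_adj {S : Set P} {g h : P} :
    (cayleyGraph S).Adj g h ↔ g ≠ h ∧ ((∃ s ∈ S, h = g * s) ∨ ∃ s ∈ S, g = h * s) :=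
  Iff.rfl

theorem cayleyGraph_reachable_mul {S : Set P} (g : P) {s : P} (hs : s ∈ S) :
    (cayleyGraph S).Reachable g (g * s) := by
  by_cases h : g = g * s
  · rw [← h]
  · exact (cayleyGraph_adj.2 ⟨h, Or.inl ⟨s, hs, rfl⟩⟩).reachable

theorem cayleyGraph_preconnected {S : Set P} (hS : Subgroup.closure S = ⊤) :
    (cayleyGraph S).Preconnected := by
  have key : ∀ g, (cayleyGraph S).Reachable 1 g := by
    intro g
    have hg : g ∈ Subgroup.closure S := hS ▸ Subgroup.mem_top g
    induction hg using Subgroup.closure_induction_right with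
    | one => exact SimpleGraph.Reachable.refl _
    | mul_right x _ y hy ih => exact ih.trans (cayleyGraph_reachable_mul x hy)
    | mul_inv_cancel x _ y hy ih =>
      refine ih.trans (SimpleGraph.Reachable.symm ?_)
      simpa using cayleyGraph_reachable_mul (x * y⁻¹) hy
  exact fun g h => (key g).symm.trans (key h)

theorem cayleyGraph_finite_neighborSet {S : Set P} (hS : S.Finite) (g : P) :
    ((cayleyGraph S).neighborSet g).Finite := by
  refine ((hS.image fun s => g * s).union (hS.image fun s => g * s⁻¹)).subset ?_
  rintro h ⟨-, ⟨s, hs, rfl⟩ | ⟨s, hs, rfl⟩⟩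
  · exact Or.inl ⟨s, hs, rfl⟩
  · exact Or.inr ⟨s, hs, by simp⟩

/-- An infinite set of vertices whose edge boundary lies in a finite set `K` contains an infinite
component of the complement of `K`, provided that there are finitely many components. -/
theorem exists_infinite_componentCompl {V : Type*} {Γ : SimpleGraph V} (K : Finset V)
    [Finite (Γ.ComponentCompl (K : Set V))] {B : Set V} (hB : B.Infinite)
    (hK : ∀ x ∉ K, ∀ y ∉ K, Γ.Adj x y → x ∈ B → y ∈ B) :
    ∃ C : Γ.ComponentCompl (K : Set V), C.supp.Infinite ∧ C.supp ⊆ B := by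
  by_contra! hcon
  refine hB ?_
  -- Otherwise `B` would be covered by `K` and the finitely many finite components.
  have hfin : (⋃ C ∈ {C : Γ.ComponentCompl (K : Set V) | C.supp.Finite}, C.supp).Finite :=
    (Set.toFinite _).biUnion fun C hC => hC
  refine (K.finite_toSet.union hfin).subset fun x hx => ?_
  by_cases hxK : x ∈ (K : Set V)
  · exact Or.inl hxK
  refine Or.inr (Set.mem_biUnion (x := Γ.componentComplMk hxK) ?_ (Γ.componentComplMk_mem hxK))
  by_contra hinf
  refine hcon _ hinf ?_
  rintro y ⟨hyK, hy⟩
  obtain ⟨p⟩ := (SimpleGraph.ConnectedComponent.exact hy).symm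
  have walk : ∀ {a b : ((K : Set V)ᶜ : Set V)}, (Γ.induce (K : Set V)ᶜ).Walk a b →
      (a : V) ∈ B → (b : V) ∈ B := by
    intro a b w
    induction w with
    | nil => exact id
    | @cons a b _ hab _ ih =>
      exact fun ha => ih (hK a (fun h => a.2 h) b (fun h => b.2 h) hab ha)
  exact walk p hx

/-- A one-ended group has no nontrivial almost invariant subsets. -/
theorem IsOneEnded.finite_or_finite_compl (hP : IsOneEnded P) {B : Set P}
    (hB : ∀ t : P, {x | x ∈ B ∧ x * t ∉ B}.Finite) : B.Finite ∨ Bᶜ.Finite := by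
  classical
  obtain ⟨T, hT, hends⟩ := hP
  by_contra! hcon
  obtain ⟨hinf, hinf'⟩ := hcon
  have : Fact (cayleyGraph (T : Set P)).Preconnected := ⟨cayleyGraph_preconnected hT⟩
  have : (cayleyGraph (T : Set P)).LocallyFinite := fun g =>
    (cayleyGraph_finite_neighborSet T.finite_toSet g).fintype
  -- This set contains every vertex of `B` with a neighbour outside `B`. Removing it cuts all edges
  -- between `B` and `Bᶜ`, so the same `K` serves both sets.
  have hL : (⋃ t ∈ T, ({x | x ∈ B ∧ x * t ∉ B} ∪ {x | x ∈ B ∧ x * t⁻¹ ∉ B})).Finite :=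
    T.finite_toSet.biUnion fun t _ => (hB t).union (hB t⁻¹)
  have hLK : ∀ x ∉ hL.toFinset, ∀ y, (cayleyGraph (T : Set P)).Adj x y → x ∈ B → y ∈ B := by
    intro x hx y hxy hxB
    by_contra hy
    refine hx (hL.mem_toFinset.2 ?_)
    obtain ⟨-, ⟨s, hs, rfl⟩ | ⟨s, hs, rfl⟩⟩ := hxy
    · exact Set.mem_biUnion hs (Or.inl ⟨hxB, hy⟩)
    · exact Set.mem_biUnion hs (Or.inr ⟨hxB, by simpa using hy⟩)
  obtain ⟨C, hC, hCB⟩ := exists_infinite_componentCompl (Γ := cayleyGraph (T : Set P))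
    hL.toFinset hinf fun x hx y _ => hLK x hx y
  obtain ⟨D, hD, hDB⟩ := exists_infinite_componentCompl (Γ := cayleyGraph (T : Set P))
    hL.toFinset hinf' fun x _ y hy hxy hxB hyB => hxB (hLK y hy x hxy.symm hyB)
  have hle : {C : (cayleyGraph (T : Set P)).ComponentCompl (hL.toFinset : Set P) |
      C.supp.Infinite}.encard ≤ 1 :=
    hends ▸ le_iSup (fun K : Finset P =>
      {C : (cayleyGraph (T : Set P)).ComponentCompl (K : Set P) | C.supp.Infinite}.encard) _
  obtain rfl : C = D := Set.encard_le_one_iff.1 hle C D hC hD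
  obtain ⟨x, hx⟩ := hC.nonempty
  exact hDB hx (hCB hx)

end OneEnded

/-! ### Restricting almost invariant sets to a subgroup -/

variable {G : Type*} [Group G]

theorem rightCoset_eq {H : Subgroup G} {a b : G} :
    rightCoset H a = rightCoset H b ↔ b * a⁻¹ ∈ H := by
  rw [rightCoset, rightCoset, Quotient.eq, QuotientGroup.rightRel_apply]

theorem IsAlmostInvariant.isHFinite_separating {H : Subgroup G} {A : Set G}
    (hA : IsAlmostInvariant H A) (t : G) : IsHFinite H {x | x ∈ A ∧ x * t ∉ A} := by
  refine (hA.coboundary t⁻¹).subset (Set.image_mono ?_)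
  rintro x ⟨hx, hxt⟩
  refine Or.inl ⟨hx, fun h => hxt ?_⟩
  rw [Set.mem_smul_set_iff_inv_smul_mem] at h
  simpa using h

/-- The nonempty fibres of `x ↦ H g⁻¹ x` on `P` are right cosets of `gHg⁻¹ ∩ P`, hence finite. -/
theorem IsHFinite.finite_preimage {H P : Subgroup G} {B : Set G} (hB : IsHFinite H B) (g : G)
    (hfin : Finite (H.map (MulAut.conj g).toMonoidHom ⊓ P : Subgroup G)) :
    {x : P | g⁻¹ * (x : G) ∈ B}.Finite := by
  refine (Set.Finite.preimage' (f := fun x : P => rightCoset H (g⁻¹ * (x : G))) hB ?_).subset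
    fun x hx => ⟨_, hx, rfl⟩
  intro b _
  obtain h | ⟨x₀, hx₀⟩ := ((fun x : P => rightCoset H (g⁻¹ * (x : G))) ⁻¹' {b}).eq_empty_or_nonempty
  · rw [h]
    exact Set.finite_empty
  refine Set.Finite.subset (Set.finite_range fun z : (H.map (MulAut.conj g).toMonoidHom ⊓ P :
    Subgroup G) => (⟨z, z.2.2⟩ * x₀ : P)) ?_
  intro x hx
  have h : rightCoset H (g⁻¹ * (x₀ : G)) = rightCoset H (g⁻¹ * (x : G)) := hx₀.trans hx.symm
  rw [rightCoset_eq] at h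
  refine ⟨⟨x * (x₀ : G)⁻¹, ⟨_, h, ?_⟩, P.mul_mem x.2 (P.inv_mem x₀.2)⟩, Subtype.ext ?_⟩
  · simp [mul_assoc]
  · simp

/-- Since `x ∈ g • A` means `g⁻¹ * x ∈ A`, the boundary of `g • A` in `P` is the pullback of an
`H`-finite set, and one-endedness applies. -/
theorem IsAlmostInvariant.finite_or_finite_compl {H P : Subgroup G} {A : Set G}
    (hA : IsAlmostInvariant H A) (hP : IsOneEnded P) (g : G)
    (hfin : Finite (H.map (MulAut.conj g).toMonoidHom ⊓ P : Subgroup G)) :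
    {x : P | (x : G) ∈ g • A}.Finite ∨ {x : P | (x : G) ∉ g • A}.Finite := by
  refine hP.finite_or_finite_compl fun t => ?_
  refine ((hA.isHFinite_separating (t : G)).finite_preimage g hfin).subset ?_
  rintro x ⟨hx, hxt⟩
  simp only [Set.mem_ofPred_eq, Set.mem_smul_set_iff_inv_smul_mem, smul_eq_mul, Subgroup.coe_mul]
    at hx hxt
  exact ⟨hx, by simpa [mul_assoc] using hxt⟩

/-- As `gHg⁻¹` stabilizes `g • A`, the translate by `q` depends only on the coset of `q` modulo a
subgroup of finite index in `P`. -/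
theorem IsAlmostInvariant.finite_translates {H P : Subgroup G} {A : Set G}
    (hA : IsAlmostInvariant H A) (g : G)
    (hfin : ((H.map (MulAut.conj g).toMonoidHom).subgroupOf P).FiniteIndex) :
    (Set.range fun q : P => (q : G) • g • A).Finite := by
  set Q := (H.map (MulAut.conj g).toMonoidHom).subgroupOf P
  have hQ : ∀ q : P, (q : G) • g • A = ((Quotient.out (q : P ⧸ Q) : P) : G) • g • A := by
    intro q
    obtain ⟨⟨z, hz⟩, hz'⟩ := QuotientGroup.mk_out_eq_mul Q q
    rw [hz']
    obtain ⟨h, hh, hzh⟩ := hz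
    have hz2 : (z : G) = g * h * g⁻¹ := hzh.symm
    rw [Subgroup.coe_mul, mul_smul]
    congr 1
    change _ = (z : G) • g • A
    rw [hz2, mul_smul, inv_smul_smul, mul_smul, hA.smul_eq h hh]
  refine (Set.finite_range fun c : P ⧸ Q => ((Quotient.out c : P) : G) • g • A).subset ?_
  rintro _ ⟨q, rfl⟩
  exact ⟨q, (hQ q).symm⟩

/-- The halfspaces containing `g` but not `h`. -/
def separating {κ : Type*} (A : κ → Set G) (g h : G) : Set (Set G) :=
  {U ∈ halfspaces A | g ∈ U ∧ h ∉ U}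

/-! ### Counting the halfspaces that separate two elements -/

variable {κ : Type*} {A : κ → Set G}

theorem compl_mem_halfspaces {U : Set G} (hU : U ∈ halfspaces A) : Uᶜ ∈ halfspaces A := by
  obtain ⟨k, g, rfl | rfl⟩ := hU
  · exact ⟨k, g, Or.inr rfl⟩
  · exact ⟨k, g, Or.inl (compl_compl _)⟩

theorem smul_mem_separating {U : Set G} {g h : G} (a : G) (hU : U ∈ separating A g h) :
    a • U ∈ separating A (a * g) (a * h) := by
  refine ⟨smul_mem_halfspaces a hU.1, Set.smul_mem_smul_set hU.2.1, fun h' => hU.2.2 ?_⟩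
  simpa [Set.mem_smul_set_iff_inv_smul_mem] using h'

/-- If `a • A` contains `g` but not `h`, then `a⁻¹ * g` lies in the `H`-finite set of `x ∈ A` with
`x * (g⁻¹ * h) ∉ A`. Its right `H`-coset determines `a • A`, because `A` is left `H`-invariant. -/
theorem IsAlmostInvariant.finite_separating {H : Subgroup G} {A : Set G}
    (hA : IsAlmostInvariant H A) (g h : G) :
    {U | ∃ a : G, U = a • A ∧ g ∈ a • A ∧ h ∉ a • A}.Finite := by
  refine ((hA.isHFinite_separating (g⁻¹ * h)).image fun c => (g * (Quotient.out c)⁻¹) • A).subset ?_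
  rintro _ ⟨a, rfl, hg, hh⟩
  rw [Set.mem_smul_set_iff_inv_smul_mem] at hg hh
  refine ⟨_, ⟨a⁻¹ * g, ⟨hg, by simpa using hh⟩, rfl⟩, ?_⟩
  have hout : rightCoset H (Quotient.out (rightCoset H (a⁻¹ * g))) = rightCoset H (a⁻¹ * g) :=
    Quotient.out_eq _
  rw [rightCoset_eq] at hout
  set c := Quotient.out (rightCoset H (a⁻¹ * g))
  have : g * c⁻¹ = a * ((a⁻¹ * g) * c⁻¹) := by group
  simp only
  rw [this, mul_smul, hA.smul_eq _ hout]

theorem finite_separating [Finite κ] {H : κ → Subgroup G}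
    (hA : ∀ k, IsAlmostInvariant (H k) (A k)) (g h : G) : (separating A g h).Finite := by
  have h1 := Set.finite_iUnion fun k => (hA k).finite_separating g h
  have h2 := (Set.finite_iUnion fun k => (hA k).finite_separating h g).image compl
  refine (h1.union h2).subset ?_
  rintro _ ⟨⟨k, a, rfl | rfl⟩, hg, hh⟩
  · exact Or.inl (Set.mem_iUnion.2 ⟨k, a, rfl, hg, hh⟩)
  · exact Or.inr ⟨_, Set.mem_iUnion.2 ⟨k, a, rfl, not_not.1 hh, hg⟩, rfl⟩

/-- The translates of a halfspace by a one-ended subgroup with full intersections which separate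
`1` from an element of this subgroup are boundedly many. -/
theorem exists_translates_separating_encard_le {H : κ → Subgroup G}
    (hA : ∀ k, IsAlmostInvariant (H k) (A k)) {P : Subgroup G} (hP : IsOneEnded P)
    (hfull : ∀ (k : κ) (g : G),
      Finite (((H k).map (MulAut.conj g).toMonoidHom ⊓ P : Subgroup G)) ∨
        (((H k).map (MulAut.conj g).toMonoidHom).subgroupOf P).FiniteIndex)
    {V : Set G} (hV : V ∈ halfspaces A) :
    ∃ N : ℕ, ∀ p : P,
      (Set.range (fun q : P => (q : G) • V) ∩ separating A 1 p).encard ≤ N := by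
  have hfin : ∀ {W : Set G}, {x : P | (x : G) ∈ W}.Finite ∨ {x : P | (x : G) ∉ W}.Finite →
      ∃ N : ℕ, ∀ p : P,
        (Set.range (fun q : P => (q : G) • W) ∩ separating A 1 p).encard ≤ N := by
    rintro W (hW | hW)
    -- From `1 ∈ q • W` it follows that `q⁻¹` lies in the finite set `W ∩ P`.
    · refine ⟨hW.toFinset.card, fun p => ?_⟩
      rw [← hW.encard_eq_coe_toFinset_card]
      refine le_trans (Set.encard_le_encard ?_)
        (Set.encard_image_le (fun x : P => ((x⁻¹ : P) : G) • W) _)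
      rintro _ ⟨⟨q, rfl⟩, -, hq, -⟩
      rw [Set.mem_smul_set_iff_inv_smul_mem] at hq
      exact ⟨q⁻¹, by simpa using hq, by simp⟩
    -- From `p ∉ q • W` it follows that `q⁻¹ * p` lies in the finite set `P \ W`, whose size does
    -- not depend on `p`.
    · refine ⟨hW.toFinset.card, fun p => ?_⟩
      rw [← hW.encard_eq_coe_toFinset_card]
      refine le_trans (Set.encard_le_encard ?_)
        (Set.encard_image_le (fun x : P => ((p * x⁻¹ : P) : G) • W) _)
      rintro _ ⟨⟨q, rfl⟩, -, -, hq⟩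
      rw [Set.mem_smul_set_iff_inv_smul_mem] at hq
      exact ⟨q⁻¹ * p, by simpa using hq, by simp⟩
  have htrans : ∀ {W : Set G}, (Set.range fun q : P => (q : G) • W).Finite →
      ∃ N : ℕ, ∀ p : P,
        (Set.range (fun q : P => (q : G) • W) ∩ separating A 1 p).encard ≤ N := by
    intro W hW
    refine ⟨hW.toFinset.card, fun p => ?_⟩
    rw [← hW.encard_eq_coe_toFinset_card]
    exact Set.encard_le_encard Set.inter_subset_left
  obtain ⟨k, g, hV⟩ := hV
  obtain h | h := hfull k g
  · apply hfin
    have := (hA k).finite_or_finite_compl hP g h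
    obtain rfl | rfl := hV
    · exact this
    · simpa using this.symm
  · apply htrans
    have := (hA k).finite_translates g h
    obtain rfl | rfl := hV
    · exact this
    · refine (this.image compl).subset ?_
      rintro _ ⟨q, rfl⟩
      exact ⟨_, ⟨q, rfl⟩, by simp only [Set.smul_set_compl]⟩

/-- A set of subsets separating `1` from a product of generators separates the endpoints of some
edge. -/
theorem exists_mem_smul_separating {P : Subgroup G} {T : Set P} (hT : Subgroup.closure T = ⊤)
    {U : Set G} (h1 : (1 : G) ∈ U) (p : P) (hp : (p : G) ∉ U) :
    ∃ q : P, ∃ t ∈ T, ((q : G) ∈ U ∧ ((q * t : P) : G) ∉ U) ∨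
      ((q : G) ∉ U ∧ ((q * t : P) : G) ∈ U) := by
  by_contra! hcon
  refine hp ?_
  have hpT : p ∈ Subgroup.closure T := hT ▸ Subgroup.mem_top p
  induction hpT using Subgroup.closure_induction_right with
  | one => exact h1
  | mul_right x _ y hy ih => exact (hcon x y hy).1 (by_contra fun h => h (ih h))
  -- Multiplying by `y⁻¹` runs backwards along the edge from `x * y⁻¹` to `x`; hence the two
  -- directions in the conclusion.
  | mul_inv_cancel x _ y hy ih =>
    by_contra h
    refine (hcon (x * y⁻¹) y hy).2 h ?_
    rw [inv_mul_cancel_right]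
    exact by_contra fun h => h (ih h)

theorem exists_separating_encard_le [Finite κ] {H : κ → Subgroup G}
    (hA : ∀ k, IsAlmostInvariant (H k) (A k)) {P : Subgroup G} (hP : IsOneEnded P)
    (hfull : ∀ (k : κ) (g : G),
      Finite (((H k).map (MulAut.conj g).toMonoidHom ⊓ P : Subgroup G)) ∨
        (((H k).map (MulAut.conj g).toMonoidHom).subgroupOf P).FiniteIndex) :
    ∃ N : ℕ, ∀ p : P, (separating A 1 p).encard ≤ N := by
  classical
  obtain ⟨T, hT, -⟩ := id hP
  have hW : (⋃ t ∈ T, (separating A 1 (t : G) ∪ separating A (t : G) 1)).Finite :=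
    T.finite_toSet.biUnion fun t _ => (finite_separating hA _ _).union (finite_separating hA _ _)
  set W := ⋃ t ∈ T, (separating A 1 (t : G) ∪ separating A (t : G) 1)
  have hWA : ∀ V ∈ W, V ∈ halfspaces A := by
    intro V hV
    obtain ⟨t, -, hV | hV⟩ := Set.mem_iUnion₂.1 hV <;> exact hV.1
  choose! N hN using fun V (hV : V ∈ W) =>
    exists_translates_separating_encard_le hA hP hfull (hWA V hV)
  refine ⟨∑ V ∈ hW.toFinset, N V, fun p => ?_⟩
  have hcover : separating A 1 (p : G) ⊆ ⋃ V ∈ hW.toFinset,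
      (Set.range (fun q : P => (q : G) • V) ∩ separating A 1 (p : G)) := by
    intro U hU
    have hWU : ∃ q : P, (q : G)⁻¹ • U ∈ W := by
      obtain ⟨q, t, ht, h⟩ := exists_mem_smul_separating hT hU.2.1 p hU.2.2
      refine ⟨q, Set.mem_biUnion ht ?_⟩
      obtain h | h := h
      · have := smul_mem_separating (q : G)⁻¹ (show U ∈ separating A _ _ from ⟨hU.1, h⟩)
        exact Or.inl (by simpa using this)
      · have := smul_mem_separating (q : G)⁻¹ (show U ∈ separating A _ _ from ⟨hU.1, h.2, h.1⟩)
        exact Or.inr (by simpa using this)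
    obtain ⟨q, hq⟩ := hWU
    exact Set.mem_biUnion (hW.mem_toFinset.2 hq) ⟨⟨q, smul_inv_smul _ _⟩, hU⟩
  refine (Set.encard_le_encard hcover).trans ?_
  push_cast
  refine (Finset.set_encard_biUnion_le _ _).trans (Finset.sum_le_sum fun V hV => ?_)
  exact hN V (hW.mem_toFinset.1 hV) p

/-! ### Vertices of the dual complex and wall flips -/

section Vertices

theorem IsVertex.mem_iff {v : Set (Set G)} (hv : IsVertex A v) {U : Set G}
    (hU : U ∈ halfspaces A) : U ∈ v ↔ Uᶜ ∉ v := by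
  have := hv.choice U hU
  unfold Xor at this
  tauto

theorem IsVertex.compl_mem_iff {v : Set (Set G)} (hv : IsVertex A v) {U : Set G}
    (hU : U ∈ halfspaces A) : Uᶜ ∈ v ↔ U ∉ v := by
  rw [hv.mem_iff hU, not_not]

theorem IsVertex.eq_of_subset {v w : Set (Set G)} (hv : IsVertex A v) (hw : IsVertex A w)
    (h : v ⊆ w) : v = w := by
  refine h.antisymm fun U hU => ?_
  have hUA := hw.subset hU
  rw [hv.mem_iff hUA]
  exact fun hc => (hw.mem_iff hUA).1 hU (h hc)

/-- The halfspaces containing `g`. -/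
def principal (A : κ → Set G) (g : G) : Set (Set G) :=
  {U ∈ halfspaces A | g ∈ U}

theorem isVertex_principal [Finite κ] {H : κ → Subgroup G}
    (hA : ∀ k, IsAlmostInvariant (H k) (A k)) (g : G) : IsVertex A (principal A g) where
  subset U hU := hU.1
  choice U hU := by
    have hU' := compl_mem_halfspaces hU
    by_cases hg : g ∈ U
    · exact Or.inl ⟨⟨hU, hg⟩, fun h => h.2 hg⟩
    · exact Or.inr ⟨⟨hU', hg⟩, fun h => hg h.2⟩
  inter U hU V hV := ⟨g, hU.2, hV.2⟩
  finite h := (finite_separating hA g h).subset fun U hU => ⟨hU.1.1, hU.1.2, hU.2⟩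

theorem smul_principal (g h : G) : g • principal A h = principal A (g * h) := by
  ext U
  rw [Set.mem_smul_set_iff_inv_smul_mem]
  constructor
  · rintro ⟨hU, hh⟩
    refine ⟨by simpa using smul_mem_halfspaces g hU, ?_⟩
    simpa [Set.mem_smul_set_iff_inv_smul_mem] using hh
  · rintro ⟨hU, hh⟩
    exact ⟨smul_mem_halfspaces g⁻¹ hU, by simpa [Set.mem_smul_set_iff_inv_smul_mem] using hh⟩

theorem flip_empty {α : Type*} (v : Set (Set α)) : flip v ∅ = v := by
  simp [flip]

theorem mem_flip_singleton {α : Type*} {v : Set (Set α)} {U V : Set α} :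
    V ∈ flip v {U} ↔ (V ∈ v ∧ V ≠ U) ∨ V = Uᶜ := by
  have h : Vᶜ = U ↔ V = Uᶜ := by rw [compl_eq_comm, eq_comm]
  simp [flip, h]

theorem ne_compl_self {α : Type*} [Nonempty α] (U : Set α) : U ≠ Uᶜ := by
  intro h
  obtain ⟨x⟩ := ‹Nonempty α›
  have := Set.ext_iff.1 h x
  simp at this

/-- Changing the side of a wall at a halfspace minimal among those separating `v` from another
vertex gives a vertex. -/
theorem IsVertex.flip_of_minimal {v w : Set (Set G)} (hv : IsVertex A v) (hw : IsVertex A w)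
    {U : Set G} (hU : Minimal (· ∈ v \ w) U) : IsVertex A (flip v {U}) := by
  have hUv := hU.prop.1
  have hUA := hv.subset hUv
  have hUw : Uᶜ ∈ w := (hw.compl_mem_iff hUA).2 hU.prop.2
  -- If `V ∈ w`, it meets `Uᶜ ∈ w`. Otherwise `V` also lies in `v \ w`, and `V ⊆ U` would contradict
  -- minimality.
  have key : ∀ V ∈ v, V ≠ U → (V ∩ Uᶜ).Nonempty := by
    intro V hV hVU
    by_cases hVw : V ∈ w
    · exact hw.inter V hVw _ hUw
    · rw [Set.inter_compl_nonempty_iff]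
      intro hle
      exact hVU (hle.antisymm (hU.le_of_le ⟨hV, hVw⟩ hle))
  have hself : (Uᶜ).Nonempty := by simpa using hw.inter _ hUw _ hUw
  refine ⟨?_, ?_, ?_, ?_⟩
  · intro V hV
    obtain ⟨hV, -⟩ | rfl := mem_flip_singleton.1 hV
    · exact hv.subset hV
    · exact compl_mem_halfspaces hUA
  · intro V hV
    have h1 := hv.mem_iff hV
    have h2 := ne_compl_self U
    simp only [Xor, mem_flip_singleton]
    by_cases hVU : V = U
    · subst hVU
      tauto
    by_cases hVU' : V = Uᶜ
    · subst hVU'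
      simp [h2]
    have h3 : Vᶜ ≠ U := fun h => hVU' (by rw [← h, compl_compl])
    have h4 : Vᶜ ≠ Uᶜ := fun h => hVU (compl_injective h)
    tauto
  · intro V hV W hW
    obtain ⟨hV, hVU⟩ | rfl := mem_flip_singleton.1 hV <;>
      obtain ⟨hW, hWU⟩ | rfl := mem_flip_singleton.1 hW
    · exact hv.inter V hV W hW
    · exact key V hV hVU
    · rw [Set.inter_comm]
      exact key W hW hWU
    · simpa using hself
  · intro g
    refine ((hv.finite g).union (Set.finite_singleton Uᶜ)).subset ?_
    rintro V ⟨hV, hg⟩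
    obtain ⟨hV, -⟩ | rfl := mem_flip_singleton.1 hV
    · exact Or.inl ⟨hV, hg⟩
    · exact Or.inr rfl

/-- The new halfspace `Uᶜ` already belongs to `w`, so a flip towards `w` lowers the number of
differing walls by exactly one when `U ∈ v \ w`. -/
theorem flip_sdiff {α : Type*} {v w : Set (Set α)} {U : Set α} (hUw : Uᶜ ∈ w) :
    flip v {U} \ w = (v \ w) \ {U} := by
  ext V
  simp only [Set.mem_sdiff, mem_flip_singleton, Set.mem_singleton_iff]
  constructor
  · rintro ⟨⟨hV, hVU⟩ | rfl, hVw⟩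
    · exact ⟨⟨hV, hVw⟩, hVU⟩
    · exact absurd hUw hVw
  · rintro ⟨⟨hV, hVw⟩, hVU⟩
    exact ⟨Or.inl ⟨hV, hVU⟩, hVw⟩

theorem IsVertex.isCube_singleton {v : Set (Set G)} (hv : IsVertex A v) : IsCube A {v} := by
  refine ⟨by simpa using hv, v, ∅, Set.finite_empty, Set.empty_subset _, ?_⟩
  ext w
  simp [Set.subset_empty_iff, flip_empty]

theorem IsVertex.isCube_pair {v : Set (Set G)} (hv : IsVertex A v) {U : Set G} (hU : U ∈ v)
    (hw : IsVertex A (flip v {U})) : IsCube A {v, flip v {U}} := by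
  refine ⟨by rintro _ (rfl | rfl) <;> assumption, v, {U}, Set.finite_singleton _,
    Set.singleton_subset_iff.2 hU, ?_⟩
  ext w
  simp only [Set.subset_singleton_iff_eq, Set.mem_insert_iff, Set.mem_singleton_iff]
  constructor
  · rintro (rfl | rfl)
    · exact ⟨∅, Or.inl rfl, (flip_empty _).symm⟩
    · exact ⟨{U}, Or.inr rfl, rfl⟩
  · rintro ⟨E, rfl | rfl, rfl⟩
    · exact Or.inl (flip_empty _)
    · exact Or.inr rfl

end Vertices

/-! ### The path metric and its comparison with the wall count -/

section Metric

/-- A vertex as a point of the dual cube complex. -/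
noncomputable def IsVertex.toPoint {v : Set (Set G)} (hv : IsVertex A v) : DualCubeComplex A :=
  ⟨vertexPoint v, {v}, hv.isCube_singleton, subset_convexHull _ _ ⟨v, rfl, rfl⟩⟩

theorem pathDist_le_of_string {x y : DualCubeComplex A} (n : ℕ) (c : ℕ → DualCubeComplex A)
    (h0 : c 0 = x) (hn : c n = y) :
    pathDist x y ≤ ∑ j ∈ Finset.range n, cubeDist (c j) (c (j + 1)) :=
  iInf_le_of_le n (iInf_le_of_le c (iInf_le_of_le h0 (iInf_le_of_le hn le_rfl)))

theorem pathDist_self (x : DualCubeComplex A) : pathDist x x = 0 := by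
  simpa using pathDist_le_of_string 0 (fun _ => x) rfl rfl

theorem pathDist_le_cubeDist (x y : DualCubeComplex A) : pathDist x y ≤ cubeDist x y := by
  simpa using pathDist_le_of_string 1 (fun j => if j = 0 then x else y) (by simp) (by simp)

theorem pathDist_triangle (x y z : DualCubeComplex A) :
    pathDist x z ≤ pathDist x y + pathDist y z := by
  conv_rhs => simp only [pathDist, ENNReal.iInf_add, ENNReal.add_iInf]
  refine le_iInf fun m => le_iInf fun d => le_iInf fun hd0 => le_iInf fun hdm => le_iInf fun n =>
    le_iInf fun c => le_iInf fun hc0 => le_iInf fun hcn => ?_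
  -- The strings `c` and `d` are concatenated. At the junction `j = 0` the two descriptions agree
  -- because `c n = y = d 0`.
  have hjoin : ∀ j, (if n + j ≤ n then c (n + j) else d (n + j - n)) = d j := by
    rintro (_ | j)
    · simp [hcn, hd0]
    · simp
  refine (pathDist_le_of_string (n + m) (fun j => if j ≤ n then c j else d (j - n))
    (by simpa using hc0) (by simpa only [hjoin] using hdm)).trans (le_of_eq ?_)
  rw [Finset.sum_range_add]
  congr 1
  · refine Finset.sum_congr rfl fun j hj => ?_
    have := Finset.mem_range.1 hj
    rw [if_pos (by lia), if_pos (by lia)]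
  · refine Finset.sum_congr rfl fun j _ => ?_
    rw [hjoin, add_assoc, hjoin]

theorem euclDist_translate (g : G) (x y : Set G → ℝ) :
    euclDist (translate g x) (translate g y) = euclDist x y := by
  unfold euclDist
  rw [← finsum_comp_equiv (MulAction.toPerm g⁻¹ : Equiv.Perm (Set G)) (f := fun U => (x U - y U) ^ 2)]
  rfl

theorem cubeDist_smul_le (g : G) (x y : DualCubeComplex A) :
    cubeDist (g • x) (g • y) ≤ cubeDist x y := by
  refine le_iInf ?_
  rintro ⟨C, hC, hx, hy⟩
  refine iInf_le_of_le ⟨g • C, hC.smul g, translate_mem_realize g hx,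
    translate_mem_realize g hy⟩ (le_of_eq ?_)
  exact congrArg ENNReal.ofReal (euclDist_translate g x.1 y.1)

theorem pathDist_smul_le (g : G) (x y : DualCubeComplex A) :
    pathDist (g • x) (g • y) ≤ pathDist x y := by
  refine le_iInf fun n => le_iInf fun c => le_iInf fun hc0 => le_iInf fun hcn => ?_
  refine (pathDist_le_of_string n (fun j => g • c j) (by simp only [hc0])
    (by simp only [hcn])).trans (Finset.sum_le_sum fun j _ => cubeDist_smul_le g _ _)

theorem cubeDist_ne_top {x y : DualCubeComplex A} {C : Set (Set (Set G))} (hC : IsCube A C)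
    (hx : x.1 ∈ realize C) (hy : y.1 ∈ realize C) : cubeDist x y ≠ ⊤ :=
  ne_top_of_le_ne_top ENNReal.ofReal_ne_top (iInf_le_of_le ⟨C, hC, hx, hy⟩ le_rfl)

theorem euclDist_vertexPoint_flip_le (v : Set (Set G)) {U : Set G} (hU : U ∈ v)
    (hU' : Uᶜ ∉ v) : euclDist (vertexPoint v) (vertexPoint (flip v {U})) ≤ 1 := by
  classical
  have hsupp : ∀ V, V ≠ U → V ≠ Uᶜ → vertexPoint v V = vertexPoint (flip v {U}) V := by
    intro V h1 h2
    simp [vertexPoint, Set.indicator_apply, mem_flip_singleton, h1, h2]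
  have hne := ne_compl_self U
  unfold euclDist
  -- Only the coordinates `U` and `Uᶜ` change, each by one; halving the sum in `euclDist` gives `1`.
  rw [Real.sqrt_le_one, finsum_eq_sum_of_support_subset (s := {U, Uᶜ}), Finset.sum_pair hne]
  · simp [vertexPoint, mem_flip_singleton, hU, hU', hne]
  · intro V hV
    by_contra h
    simp only [Finset.coe_insert, Finset.coe_singleton, Set.mem_insert_iff,
      Set.mem_singleton_iff, not_or] at h
    exact hV (by simp [hsupp V h.1 h.2])

theorem IsVertex.cubeDist_flip_le {v : Set (Set G)} (hv : IsVertex A v) {U : Set G} (hU : U ∈ v)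
    (hw : IsVertex A (flip v {U})) : cubeDist hv.toPoint hw.toPoint ≤ 1 := by
  refine iInf_le_of_le ⟨_, hv.isCube_pair hU hw, subset_convexHull _ _ ⟨v, Or.inl rfl, rfl⟩,
    subset_convexHull _ _ ⟨_, Or.inr rfl, rfl⟩⟩ ?_
  rw [← ENNReal.ofReal_one]
  exact ENNReal.ofReal_le_ofReal
    (euclDist_vertexPoint_flip_le v hU ((hv.mem_iff (hv.subset hU)).1 hU))

/-- The distance of two vertices is at most the number of walls separating them. -/
theorem IsVertex.pathDist_le {v w : Set (Set G)} (hv : IsVertex A v) (hw : IsVertex A w) (n : ℕ)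
    (hn : (v \ w).encard = n) : pathDist hv.toPoint hw.toPoint ≤ n := by
  induction n generalizing v with
  | zero =>
    have h : v \ w = ∅ := by simpa using hn
    obtain rfl := hv.eq_of_subset hw (Set.sdiff_eq_empty.1 h)
    rw [pathDist_self]
    simp
  | succ n ih =>
    have hfin : (v \ w).Finite := Set.finite_of_encard_eq_coe hn
    have hne : (v \ w).Nonempty := by
      rw [← Set.encard_pos, hn]
      simp
    -- Flipping a minimal element of `v \ w` gives a vertex one wall closer to `w`, adjacent to `v`.
    obtain ⟨U, hU⟩ := hfin.exists_minimal hne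
    have hv' := hv.flip_of_minimal hw hU
    have hUw : Uᶜ ∈ w := (hw.compl_mem_iff (hv.subset hU.prop.1)).2 hU.prop.2
    have hcard : (flip v {U} \ w).encard = n := by
      rw [flip_sdiff hUw]
      have := Set.encard_sdiff_singleton_add_one hU.prop
      rw [hn] at this
      push_cast at this
      exact ENat.add_left_injective_of_ne_top ENat.one_ne_top this
    calc pathDist hv.toPoint hw.toPoint
        ≤ pathDist hv.toPoint hv'.toPoint + pathDist hv'.toPoint hw.toPoint :=
          pathDist_triangle _ _ _
      _ ≤ 1 + n := add_le_add ((pathDist_le_cubeDist _ _).trans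
          (hv.cubeDist_flip_le hU.prop.1 hv')) (ih hv' hcard)
      _ = ((n + 1 : ℕ) : ℝ≥0∞) := by push_cast; rw [add_comm]

theorem IsVertex.pathDist_le_of_encard_le {v w : Set (Set G)} (hv : IsVertex A v)
    (hw : IsVertex A w) {n : ℕ} (hn : (v \ w).encard ≤ n) :
    pathDist hv.toPoint hw.toPoint ≤ n := by
  obtain ⟨m, hm, hmn⟩ := ENat.le_natCast_iff.1 hn
  exact (hv.pathDist_le hw m hm).trans (by exact_mod_cast hmn)

theorem IsVertex.pathDist_ne_top {v w : Set (Set G)} (hv : IsVertex A v)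
    (hw : IsVertex A w) (h : (v \ w).Finite) : pathDist hv.toPoint hw.toPoint ≠ ⊤ :=
  ne_top_of_le_ne_top (ENNReal.natCast_ne_top _) (hv.pathDist_le hw _ h.encard_eq_coe)

/-- With its mirror image below, this puts every vertex at finite distance from the principal
vertices, in both directions. -/
theorem IsVertex.finite_sdiff_principal {v : Set (Set G)} (hv : IsVertex A v) (g : G) :
    (v \ principal A g).Finite :=
  (hv.finite g).subset fun _ hU => ⟨hU.1, fun h => hU.2 ⟨hv.subset hU.1, h⟩⟩

theorem IsVertex.finite_principal_sdiff {v : Set (Set G)} (hv : IsVertex A v) (g : G) :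
    (principal A g \ v).Finite := by
  refine ((hv.finite g).image compl).subset ?_
  rintro U ⟨⟨hU, hg⟩, hUv⟩
  exact ⟨Uᶜ, ⟨(hv.compl_mem_iff hU).2 hUv, fun h => h hg⟩, compl_compl U⟩

/-- Any vertex of a cube containing `x` will do. Both directions are recorded because both enter the
final bound. -/
theorem exists_vertex_pathDist_ne_top (x : DualCubeComplex A) :
    ∃ (v : Set (Set G)) (hv : IsVertex A v),
      pathDist x hv.toPoint ≠ ⊤ ∧ pathDist hv.toPoint x ≠ ⊤ := by
  obtain ⟨C, hC, hx⟩ := x.2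
  obtain ⟨_, v, hvC, rfl⟩ := convexHull_nonempty_iff.1 ⟨x.1, hx⟩
  have hv := hC.1 v hvC
  have hvr : vertexPoint v ∈ realize C := subset_convexHull _ _ ⟨v, hvC, rfl⟩
  exact ⟨v, hv, ne_top_of_le_ne_top (cubeDist_ne_top hC hx hvr) (pathDist_le_cubeDist _ _),
    ne_top_of_le_ne_top (cubeDist_ne_top hC hvr hx) (pathDist_le_cubeDist _ _)⟩

theorem IsVertex.smul_toPoint {v : Set (Set G)} (hv : IsVertex A v) (g : G) :
    g • hv.toPoint = (hv.smul g).toPoint :=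
  Subtype.ext (translate_vertexPoint g v)

end Metric

/-- A subgroup acts elliptically if boundedly many halfspaces separate `1` from its elements. -/
theorem actsElliptically_of_encard_separating_le [Finite κ] {H : κ → Subgroup G}
    (hA : ∀ k, IsAlmostInvariant (H k) (A k)) {P : Subgroup G} {N : ℕ}
    (hN : ∀ p ∈ P, (separating A 1 p).encard ≤ N) : ActsElliptically A P := by
  have hv₁ := isVertex_principal hA 1
  refine ⟨⟨hv₁.toPoint⟩, fun x => ?_⟩
  obtain ⟨v, hv, hxv, hvx⟩ := exists_vertex_pathDist_ne_top x
  have h1 : pathDist x hv₁.toPoint ≠ ⊤ := ne_top_of_le_ne_top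
    (ENNReal.add_ne_top.2 ⟨hxv, hv.pathDist_ne_top hv₁ (hv.finite_sdiff_principal 1)⟩)
    (pathDist_triangle _ hv.toPoint _)
  have h2 : pathDist hv₁.toPoint x ≠ ⊤ := ne_top_of_le_ne_top
    (ENNReal.add_ne_top.2 ⟨hv₁.pathDist_ne_top hv (hv.finite_principal_sdiff 1), hvx⟩)
    (pathDist_triangle _ hv.toPoint _)
  -- The bound follows the route `x → v₁ → p • v₁ → p • x`: the middle leg is at most `N`, and the
  -- last is no longer than that from `v₁` to `x`. Finiteness of the sum matters, since `toReal`
  -- sends `⊤` to `0`.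
  refine ⟨(pathDist x hv₁.toPoint + (N + pathDist hv₁.toPoint x)).toReal, fun p hp => ?_⟩
  rw [ENNReal.ofReal_toReal (ENNReal.add_ne_top.2
    ⟨h1, ENNReal.add_ne_top.2 ⟨ENNReal.natCast_ne_top N, h2⟩⟩)]
  have hcard : (principal A 1 \ p • principal A 1).encard ≤ N := by
    refine (Set.encard_le_encard ?_).trans (hN p hp)
    rintro U ⟨⟨hU, h1U⟩, hpU⟩
    rw [smul_principal, mul_one] at hpU
    exact ⟨hU, h1U, fun h => hpU ⟨hU, h⟩⟩
  refine (pathDist_triangle _ hv₁.toPoint _).trans (add_le_add le_rfl ?_)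
  refine (pathDist_triangle _ (p • hv₁.toPoint) _).trans
    (add_le_add ?_ (pathDist_smul_le p _ _))
  rw [hv₁.smul_toPoint]
  exact hv₁.pathDist_le_of_encard_le (hv₁.smul p) hcard

end RelCube

theorem propositionp {G : Type*} [Group G] [Group.FG G]
    {ι : Type*} [Finite ι] (P : ι → Subgroup G)
    (hP : RelCube.IsRelativelyHyperbolic P)
    {κ : Type*} [Finite κ] (H : κ → Subgroup G)
    (hqc : ∀ k, RelCube.IsRelativelyQuasiconvex P (H k))
    (hfull : ∀ k, RelCube.IsFull P (H k))
    (hcodim : ∀ k, RelCube.IsCodimensionOne (H k))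
    (A : κ → Set G) (hA : ∀ k, RelCube.IsAlmostInvariant (H k) (A k))
    (i : ι) (hi : RelCube.IsOneEnded (P i)) :
    RelCube.ActsElliptically A (P i) := by
  obtain ⟨N, hN⟩ := RelCube.exists_separating_encard_le hA hi fun k g => hfull k g i
  exact RelCube.actsElliptically_of_encard_separating_le hA fun p hp => hN ⟨p, hp⟩
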